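/- Let $n,m,N\ge 0$ be integers and $\mathcal X\subseteq\mathbb R^n$. Consider the control-affine system $\dot x=f(x)+g(x)u$, where $f:\mathcal X\to\mathbb R^n$ and $g:\mathcal X\to\mathbb R^{n\times m}$ are continuous and $u$ takes values in the nonempty box $\mathcal U=\{u\in\mathbb R^m: u_{\min}\le u\le u_{\max}\}$. Let $\Omega\subseteq\mathcal X$ be a closed and bounded set whose boundary $\partial\Omega$ is an embedded $C^1$ hypersurface of $\mathbb R^n$ with an inward pointing unit normal $n(x)$ at every $x\in\partial\Omega$ (a unit vector orthogonal to the tangent space of $\partial\Omega$ at $x$ with $x+s\,n(x)\in\Omega$ for all small $s>0$). For $x\in\partial\Omega$ put $$b^*(x)=\sup_{u\in\mathcal U} n(x)^T\bigl(f(x)+g(x)u\bigr).$$ Let $\mathcal L_{nf},\mathcal L_{ng}\ge 0$ be Lipschitz constants, with respect to Euclidean norms, of $x\mapsto n(x)^Tf(x)$ and $x\mapsto n(x)^Tg(x)$ on $\partial\Omega$, let $$\mathcal L_{LP}=\sup_{c\ne\tilde c}\frac{|\vartheta(c)-\vartheta(\tilde c)|}{\|c-\tilde c\|_2},\qquad \vartheta(c)=\min_{w\in\mathcal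 U}c^Tw\quad(c\in\mathbb R^m)$$ (with $\mathcal L_{LP}=0$ if $m=0$), and put $\mathcal L_b=\mathcal L_{nf}+\mathcal L_{LP}\,\mathcal L_{ng}$. Suppose that there are control points $x_1,\dots,x_N\in\partial\Omega$ and radii $r_1,\dots,r_N\ge 0$ such that $$\partial\Omega\subseteq\bigcup_{i=1}^N\mathcal B_{r_i}(x_i)\qquad\text{and}\qquad b^*(x_i)\ge\mathcal L_b\,r_i\ge 0\quad\text{for all } i=1,\dots,N,$$ where $\mathcal B_r(x)$ is the closed Euclidean ball of radius $r$ about $x$. Then $\Omega$ is control invariant: for every $t_0\in\mathbb R$ and every $x_0\in\Omega$ there are a measurable input $u:[t_0,\infty)\to\mathcal U$ and a solution $x:[t_0,\infty)\to\mathbb R^n$ of $\dot x=f(x)+g(x)u$ (in the integral sense, i.e. for almost every $t$) with $x(t_0)=x_0$ and $x(t)\in\Omega$ for all $t\ge t_0$. -/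

import Mathlib

open scoped NNReal Topology

noncomputable section

namespace ControlInvariance

/-- The box of feasible inputs `{u ∈ ℝᵐ | u_min ≤ u ≤ u_max}` (componentwise). -/
def inputBox {m : ℕ} (umin umax : EuclideanSpace ℝ (Fin m)) : Set (EuclideanSpace ℝ (Fin m)) :=
  {u | ∀ j, umin j ≤ u j ∧ u j ≤ umax j}

/-- `h` is a `C¹` function on the open set `V` with nowhere vanishing derivative, and the part of
`S` in `V` is the zero set of `h` in `V`. -/
structure IsC1DefiningFunction {n : ℕ} (S : Set (EuclideanSpace ℝ (Fin n)))
    (V : Set (EuclideanSpace ℝ (Fin n))) (h : EuclideanSpace ℝ (Fin n) → ℝ) : Prop where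
  isOpen : IsOpen V
  contDiffOn : ContDiffOn ℝ 1 h V
  fderiv_ne_zero : ∀ y ∈ V, fderiv ℝ h y ≠ 0
  mem_iff : ∀ y ∈ V, y ∈ S ↔ h y = 0

/-- `S` is an embedded `C¹` submanifold of `ℝⁿ` of dimension `n - 1`. -/
def IsC1Hypersurface {n : ℕ} (S : Set (EuclideanSpace ℝ (Fin n))) : Prop :=
  ∀ x ∈ S, ∃ V h, x ∈ V ∧ IsC1DefiningFunction S V h

/-- `v` is orthogonal to the tangent space of the hypersurface `S` at `x`, the tangent space being
the kernel of the derivative of a local defining function (it does not depend on the choice of that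
function). -/
def IsNormalVector {n : ℕ} (S : Set (EuclideanSpace ℝ (Fin n)))
    (x v : EuclideanSpace ℝ (Fin n)) : Prop :=
  ∃ V h, x ∈ V ∧ IsC1DefiningFunction S V h ∧ ∀ w, fderiv ℝ h x w = 0 → inner ℝ v w = 0

/-- `v` is the inward pointing unit normal of `Ω` at the boundary point `x`: a unit vector, normal
to the boundary, such that the points `x + s v` with small `s > 0` lie in `Ω`. -/
structure IsInwardUnitNormal {n : ℕ} (Ω : Set (EuclideanSpace ℝ (Fin n)))
    (x v : EuclideanSpace ℝ (Fin n)) : Prop where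
  norm_eq_one : ‖v‖ = 1
  isNormal : IsNormalVector (frontier Ω) x v
  inward : ∀ᶠ s : ℝ in 𝓝[>] 0, x + s • v ∈ Ω

/-- The optimal value of the linear program: maximize `n(x)ᵀ (f(x) + g(x) u)` over the inputs `u`
in the box. -/
def flowMargin {n m : ℕ} (f : EuclideanSpace ℝ (Fin n) → EuclideanSpace ℝ (Fin n))
    (g : EuclideanSpace ℝ (Fin n) → EuclideanSpace ℝ (Fin m) →L[ℝ] EuclideanSpace ℝ (Fin n))
    (umin umax : EuclideanSpace ℝ (Fin m))
    (ν : EuclideanSpace ℝ (Fin n) → EuclideanSpace ℝ (Fin n))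
    (x : EuclideanSpace ℝ (Fin n)) : ℝ :=
  sSup ((fun u => inner ℝ (ν x) (f x + g x u)) '' inputBox umin umax)

/-- The optimal value `ϑ(c)` of the box constrained linear program: minimize `cᵀ w` subject to
`w_min ≤ w ≤ w_max`. -/
def boxLPValue {m : ℕ} (wmin wmax c : EuclideanSpace ℝ (Fin m)) : ℝ :=
  sInf ((fun w => inner ℝ c w) '' inputBox wmin wmax)

/-- The best Lipschitz constant of the optimal value of the box constrained linear program under
perturbations of the cost vector: the supremum of `|ϑ(c) - ϑ(c')| / ‖c - c'‖`. The pairs with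
`c = c'` contribute `0 / 0 = 0` and do not affect the supremum. -/
def boxLPLipschitz {m : ℕ} (wmin wmax : EuclideanSpace ℝ (Fin m)) : ℝ :=
  ⨆ p : EuclideanSpace ℝ (Fin m) × EuclideanSpace ℝ (Fin m),
    |boxLPValue wmin wmax p.1 - boxLPValue wmin wmax p.2| / ‖p.1 - p.2‖

/-- On `[t₀, ∞)`, the curve `x` is a Carathéodory solution of `ẋ = f(x) + g(x) u` for the input
signal `u`. -/
structure IsTrajectory {n m : ℕ} (f : EuclideanSpace ℝ (Fin n) → EuclideanSpace ℝ (Fin n))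
    (g : EuclideanSpace ℝ (Fin n) → EuclideanSpace ℝ (Fin m) →L[ℝ] EuclideanSpace ℝ (Fin n))
    (t₀ : ℝ) (u : ℝ → EuclideanSpace ℝ (Fin m)) (x : ℝ → EuclideanSpace ℝ (Fin n)) : Prop where
  continuousOn : ContinuousOn x (Set.Ici t₀)
  intervalIntegrable : ∀ t, t₀ ≤ t →
    IntervalIntegrable (fun s => f (x s) + g (x s) (u s)) MeasureTheory.volume t₀ t
  eq_integral : ∀ t, t₀ ≤ t → x t = x t₀ + ∫ s in t₀..t, (f (x s) + g (x s) (u s))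

/-- `C` is control invariant for `ẋ = f(x) + g(x) u`, `u ∈ U`: from every initial condition
`x(t₀) ∈ C`, some measurable input signal with values in `U` keeps the state in `C` for all
`t ≥ t₀`. -/
def IsControlInvariant {n m : ℕ} (f : EuclideanSpace ℝ (Fin n) → EuclideanSpace ℝ (Fin n))
    (g : EuclideanSpace ℝ (Fin n) → EuclideanSpace ℝ (Fin m) →L[ℝ] EuclideanSpace ℝ (Fin n))
    (U : Set (EuclideanSpace ℝ (Fin m))) (C : Set (EuclideanSpace ℝ (Fin n))) : Prop :=
  ∀ t₀ : ℝ, ∀ x₀ ∈ C, ∃ (u : ℝ → EuclideanSpace ℝ (Fin m)) (x : ℝ → EuclideanSpace ℝ (Fin n)),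
    Measurable u ∧ (∀ t, t₀ ≤ t → u t ∈ U) ∧ IsTrajectory f g t₀ u x ∧ x t₀ = x₀ ∧
      ∀ t, t₀ ≤ t → x t ∈ C

end ControlInvariance

end

namespace ControlInvariance

/-! The margin `b*` is Lipschitz on the boundary with constant `Lb` (`flowMargin_sub_le`), so its
values at the control points force `b* ≥ 0` on all of `∂Ω`. The supremum is attained, hence every
boundary point has an admissible velocity `v` with nonnegative component along the inward normal.
Tilting `v` by `ε` times the normal moves it into a strict inward cone, which near the point lies in
`Ω` (`IsInwardUnitNormal.eventually_mem`). Short steps with relative error `ε` are thus possible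
everywhere: `HasViableSteps`.

The rest is a Nagumo-type viability theorem for merely continuous data. By compactness the steps can
be bounded below, so Euler schemes in `Ω` reach all times. The inputs themselves may oscillate as
the error tends to zero, so the quantity passed to the limit is the accumulated input `W`, the time
integral of the input. Since the dynamics is affine in `u`, the increment of the state is, to first
order, `f` times elapsed time plus `g` applied to the increment of `W`, and this survives the limit
(`exists_viable_pair`). Both limits are Lipschitz, hence differentiable almost everywhere. The
control is `W'`, which is measurable and takes values in `U` because `U` is convex and closed. -/

/-- A preconnected set that meets `s` and avoids its frontier lies in `s`. -/
lemma subset_of_isPreconnected_of_disjoint_frontier {α : Type*} [TopologicalSpace α] {s t : Set α}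
    (ht : IsPreconnected t) (hd : Disjoint (frontier s) t) (hne : (s ∩ t).Nonempty) : t ⊆ s := by
  have hsub : t ⊆ interior s ∪ (closure s)ᶜ := by
    intro y hy
    by_contra hcon
    simp only [Set.mem_union, Set.mem_compl_iff, not_or, not_not] at hcon
    exact Set.disjoint_left.1 hd ⟨hcon.2, hcon.1⟩ hy
  have hdis : Disjoint (interior s) (closure s)ᶜ :=
    Set.disjoint_left.2 fun y hy hy' => hy' (subset_closure (interior_subset hy))
  refine (ht.subset_left_of_subset_union isOpen_interior isClosed_closure.isOpen_compl hdis hsub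
    ?_).trans interior_subset
  obtain ⟨y, hys, hyt⟩ := hne
  refine ⟨y, hyt, ?_⟩
  rcases hsub hyt with h | h
  · exact h
  · exact absurd (subset_closure hys) h

/-! ### Inward cones at a `C¹` boundary. -/

section Geometry

variable {n : ℕ} {Ω : Set (EuclideanSpace ℝ (Fin n))} {x v : EuclideanSpace ℝ (Fin n)}

/-- The derivative of a defining function is a nonzero multiple of the inner product with the unit
normal. -/
lemma exists_fderiv_eq_inner_of_isNormalVector {S : Set (EuclideanSpace ℝ (Fin n))}
    (hv : ‖v‖ = 1) (hn : IsNormalVector S x v) :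
    ∃ V h c, x ∈ V ∧ IsC1DefiningFunction S V h ∧ c ≠ 0 ∧
      ∀ w, fderiv ℝ h x w = c * inner ℝ v w := by
  obtain ⟨V, h, hxV, hh, hker⟩ := hn
  obtain ⟨w₀, hw₀⟩ : ∃ w₀, fderiv ℝ h x w₀ ≠ 0 := by
    by_contra hcon
    push Not at hcon
    exact hh.fderiv_ne_zero x hxV (ContinuousLinearMap.ext hcon)
  -- The combination of `w` and `w₀` used here lies in the kernel of the derivative, so `v` is
  -- orthogonal to it.
  have key : ∀ w, fderiv ℝ h x w₀ * inner ℝ v w = fderiv ℝ h x w * inner ℝ v w₀ := by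
    intro w
    have := hker (fderiv ℝ h x w₀ • w - fderiv ℝ h x w • w₀) (by simp; ring)
    simp only [inner_sub_right, inner_smul_right] at this
    linarith
  have hvv : inner ℝ v v = (1 : ℝ) := by simp [hv]
  have hv0 := key v
  rw [hvv, mul_one] at hv0
  refine ⟨V, h, fderiv ℝ h x v, hxV, hh, ?_, ?_⟩
  · intro h0
    rw [h0, zero_mul] at hv0
    exact hw₀ hv0
  · intro w
    refine mul_left_cancel₀ hw₀ ?_
    have h1 := key w
    calc fderiv ℝ h x w₀ * fderiv ℝ h x w
        = fderiv ℝ h x v * (fderiv ℝ h x w * inner ℝ v w₀) := by rw [hv0]; ring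
      _ = fderiv ℝ h x w₀ * (fderiv ℝ h x v * inner ℝ v w) := by rw [← h1]; ring

/-- Every strict cone around the inward pointing normal is locally contained in `Ω`. -/
lemma IsInwardUnitNormal.eventually_mem (hv : IsInwardUnitNormal Ω x v)
    (hx : x ∈ frontier Ω) {ε : ℝ} (hε : 0 < ε) :
    ∃ δ > 0, ∀ w : EuclideanSpace ℝ (Fin n), ‖w‖ < δ → w ≠ 0 → ε * ‖w‖ ≤ inner ℝ v w →
      x + w ∈ Ω := by
  -- With `ε ≤ 1` the ray along `v` itself belongs to the cone.
  wlog hε1 : ε ≤ 1 generalizing ε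
  · obtain ⟨δ, hδ, h⟩ := this one_pos le_rfl
    refine ⟨δ, hδ, fun w hw hw0 hin => h w hw hw0 (le_trans ?_ hin)⟩
    gcongr
    linarith
  obtain ⟨V, h, c, hxV, hh, hc, hder⟩ :=
    exists_fderiv_eq_inner_of_isNormalVector hv.norm_eq_one hv.isNormal
  have hVn : V ∈ 𝓝 x := hh.isOpen.mem_nhds hxV
  have hdiff : HasFDerivAt h (fderiv ℝ h x) x :=
    ((hh.contDiffOn.contDiffAt hVn).differentiableAt (by norm_num)).hasFDerivAt
  have hlit := (hasFDerivAt_iff_isLittleO_nhds_zero.1 hdiff).def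
    (c := |c| * ε / 2) (by positivity)
  have hV0 : ∀ᶠ w in 𝓝 (0 : EuclideanSpace ℝ (Fin n)), x + w ∈ V := by
    have : Filter.Tendsto (fun w => x + w) (𝓝 (0 : EuclideanSpace ℝ (Fin n))) (𝓝 x) := by
      simpa using (continuous_const_add x).tendsto 0
    exact this.eventually hVn
  obtain ⟨δ, hδ, hball⟩ := Metric.eventually_nhds_iff.1 (hlit.and hV0)
  obtain ⟨δ', hδ', hin⟩ := mem_nhdsGT_iff_exists_Ioo_subset.1 hv.inward
  rw [Set.mem_Ioi] at hδ'
  have hhx : h x = 0 := (hh.mem_iff x hxV).1 hx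
  -- At a frontier point `h` vanishes, so the linear term, at least `|c| ε ‖w‖` on the cone, would
  -- be bounded by the Taylor error `|c| ε ‖w‖ / 2`.
  have hcone : ∀ w : EuclideanSpace ℝ (Fin n), ‖w‖ < δ → w ≠ 0 → ε * ‖w‖ ≤ inner ℝ v w →
      x + w ∉ frontier Ω := by
    intro w hw hw0 hin hfr
    obtain ⟨h1, h2⟩ := hball (y := w) (by simpa using hw)
    rw [(hh.mem_iff _ h2).1 hfr, hhx, hder] at h1
    have hw' : 0 < ‖w‖ := norm_pos_iff.2 hw0
    have hc' : 0 < |c| := abs_pos.2 hc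
    simp only [sub_zero, zero_sub, norm_neg, Real.norm_eq_abs, abs_mul] at h1
    have h3 := le_abs_self (inner ℝ v w : ℝ)
    have h4 : |c| * (ε * ‖w‖) ≤ |c| * |inner ℝ v w| := by gcongr; linarith
    have h5 : 0 < |c| * ε * ‖w‖ := by positivity
    linarith
  refine ⟨δ, hδ, fun w hw hw0 hwin => ?_⟩
  set s : ℝ := min (δ / 2) (δ' / 2) with hs
  have hs0 : 0 < s := by positivity
  have hsδ : s < δ := by have := min_le_left (δ / 2) (δ' / 2); linarith
  have hsδ' : s < δ' := by have := min_le_right (δ / 2) (δ' / 2); linarith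
  have hvv : inner ℝ v v = (1 : ℝ) := by simp [hv.norm_eq_one]
  have hnsv : ‖s • v‖ = s := by rw [norm_smul, hv.norm_eq_one, Real.norm_of_nonneg hs0.le, mul_one]
  have hw' : 0 < ‖w‖ := norm_pos_iff.2 hw0
  -- The truncated cone is convex and avoids zero along this segment, so the segment joins `x + w`
  -- to the known point `x + s • v` of `Ω` without meeting the frontier.
  have hdis : Disjoint (frontier Ω) ((fun y => x + y) '' segment ℝ (s • v) w) := by
    rw [Set.disjoint_left]
    rintro _ hfr ⟨y, ⟨a, b, ha, hb, hab, rfl⟩, rfl⟩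
    have hny : ‖a • s • v + b • w‖ ≤ a * s + b * ‖w‖ := by
      refine (norm_add_le _ _).trans ?_
      rw [norm_smul a, norm_smul b, hnsv, Real.norm_of_nonneg ha, Real.norm_of_nonneg hb]
    have hiny : inner ℝ v (a • s • v + b • w) = a * s + b * inner ℝ v w := by
      simp only [inner_add_right, inner_smul_right, hvv]
      ring
    have hlow : a * s + b * (ε * ‖w‖) ≤ inner ℝ v (a • s • v + b • w) := by
      rw [hiny]; gcongr
    have hpos : 0 < a * s + b * (ε * ‖w‖) := by
      rcases ha.eq_or_lt with rfl | ha
      · have : b = 1 := by linarith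
        subst this
        positivity
      · positivity
    refine hcone _ (hny.trans_lt ?_) ?_ ?_ hfr
    · rcases ha.eq_or_lt with rfl | ha
      · have : b = 1 := by linarith
        subst this
        simpa using hw
      · calc a * s + b * ‖w‖ < a * δ + b * δ :=
            add_lt_add_of_lt_of_le (by gcongr) (by gcongr)
          _ = δ := by rw [← add_mul, hab, one_mul]
    · intro h0
      rw [h0, inner_zero_right] at hlow
      linarith
    · refine le_trans ?_ hlow
      calc ε * ‖a • s • v + b • w‖ ≤ ε * (a * s + b * ‖w‖) := by gcongr
        _ = ε * (a * s) + b * (ε * ‖w‖) := by ring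
        _ ≤ 1 * (a * s) + b * (ε * ‖w‖) := by gcongr
        _ = _ := by rw [one_mul]
  refine subset_of_isPreconnected_of_disjoint_frontier
    ((convex_segment (s • v) w).isPreconnected.image _ (continuous_const_add x).continuousOn)
    hdis ⟨x + s • v, hin ⟨hs0, hsδ'⟩, _, left_mem_segment ℝ _ _, rfl⟩
    ⟨w, right_mem_segment ℝ _ _, rfl⟩

end Geometry

/-! ### Lipschitz dependence of the box linear program and of the flow margin. -/

section LinearProgram

variable {m : ℕ} {umin umax : EuclideanSpace ℝ (Fin m)}

lemma convex_inputBox : Convex ℝ (inputBox umin umax) := by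
  intro u hu v hv a b ha hb hab j
  have h1 := hu j
  have h2 := hv j
  have hb' : b = 1 - a := by linarith
  simp only [PiLp.add_apply, PiLp.smul_apply, smul_eq_mul]
  constructor
  · calc umin j = a * umin j + b * umin j := by rw [hb']; ring
      _ ≤ _ := by gcongr; exacts [h1.1, h2.1]
  · calc _ ≤ a * umax j + b * umax j := by gcongr; exacts [h1.2, h2.2]
      _ = umax j := by rw [hb']; ring

lemma isCompact_inputBox : IsCompact (inputBox umin umax) := by
  have : inputBox umin umax =
      (EuclideanSpace.equiv (Fin m) ℝ).toHomeomorph ⁻¹' Set.pi Set.univ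
        fun j => Set.Icc (umin j) (umax j) := by
    ext u
    simp only [inputBox, Set.mem_ofPred_eq, Set.mem_preimage, Set.mem_univ_pi, Set.mem_Icc]
    rfl
  rw [this, Homeomorph.isCompact_preimage]
  exact isCompact_univ_pi fun j => isCompact_Icc

lemma exists_boxLPValue_eq (hu : ∀ j, umin j ≤ umax j) (c : EuclideanSpace ℝ (Fin m)) :
    ∃ w ∈ inputBox umin umax, boxLPValue umin umax c = inner ℝ c w ∧
      ∀ w' ∈ inputBox umin umax, boxLPValue umin umax c ≤ inner ℝ c w' := by
  have hne : (inputBox umin umax).Nonempty := ⟨umin, fun j => ⟨le_rfl, hu j⟩⟩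
  have hcont : Continuous fun w : EuclideanSpace ℝ (Fin m) => (inner ℝ c w : ℝ) := by fun_prop
  obtain ⟨w, hw, heq⟩ := isCompact_inputBox.exists_sInf_image_eq hne hcont.continuousOn
  refine ⟨w, hw, heq, fun w' hw' => csInf_le ?_ ⟨w', hw', rfl⟩⟩
  exact (isCompact_inputBox.image hcont).bddBelow

/-- A minimiser for one cost competes for the other, so a bound `R` on the box bounds all the
quotients. This makes the supremum genuine: an unbounded real `⨆` would take the default value `0`.
-/
lemma abs_boxLPValue_sub_le (hu : ∀ j, umin j ≤ umax j) (c c' : EuclideanSpace ℝ (Fin m)) :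
    |boxLPValue umin umax c - boxLPValue umin umax c'| ≤
      boxLPLipschitz umin umax * ‖c - c'‖ := by
  obtain ⟨R, hR⟩ := (isCompact_inputBox (umin := umin) (umax := umax)).isBounded.exists_norm_le
  have hone : ∀ c c' : EuclideanSpace ℝ (Fin m),
      boxLPValue umin umax c - boxLPValue umin umax c' ≤ R * ‖c - c'‖ := by
    intro c c'
    obtain ⟨w, hw, heq, -⟩ := exists_boxLPValue_eq hu c'
    obtain ⟨-, -, -, hle⟩ := exists_boxLPValue_eq hu c
    calc boxLPValue umin umax c - boxLPValue umin umax c'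
        ≤ inner ℝ c w - inner ℝ c' w := by rw [heq]; linarith [hle w hw]
      _ = inner ℝ (c - c') w := by rw [inner_sub_left]
      _ ≤ ‖c - c'‖ * ‖w‖ := real_inner_le_norm _ _
      _ ≤ ‖c - c'‖ * R := by gcongr; exact hR w hw
      _ = R * ‖c - c'‖ := mul_comm _ _
  have hbdd : BddAbove (Set.range fun p : EuclideanSpace ℝ (Fin m) × EuclideanSpace ℝ (Fin m) =>
      |boxLPValue umin umax p.1 - boxLPValue umin umax p.2| / ‖p.1 - p.2‖) := by
    refine ⟨R, ?_⟩
    rintro _ ⟨p, rfl⟩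
    have hR0 : 0 ≤ R := (norm_nonneg _).trans (hR umin fun j => ⟨le_rfl, hu j⟩)
    refine div_le_of_le_mul₀ (norm_nonneg _) hR0 (abs_le.2 ⟨?_, hone _ _⟩)
    have := hone p.2 p.1
    rw [norm_sub_rev] at this
    linarith
  rcases eq_or_ne c c' with rfl | hne
  · simp
  · rw [← div_le_iff₀ (norm_pos_iff.2 (sub_ne_zero.2 hne))]
    exact le_ciSup hbdd (c, c')

lemma boxLPLipschitz_nonneg : 0 ≤ boxLPLipschitz umin umax :=
  Real.iSup_nonneg fun _ => by positivity

variable {n : ℕ} (f : EuclideanSpace ℝ (Fin n) → EuclideanSpace ℝ (Fin n))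
    (g : EuclideanSpace ℝ (Fin n) → EuclideanSpace ℝ (Fin m) →L[ℝ] EuclideanSpace ℝ (Fin n))
    (ν : EuclideanSpace ℝ (Fin n) → EuclideanSpace ℝ (Fin n))

/-- Moving `g x` to the other side of the inner product turns the maximisation into a minimisation
with cost `-(g x)ᵀ ν x`; a minimiser exists by compactness. -/
lemma flowMargin_eq (hu : ∀ j, umin j ≤ umax j) (x : EuclideanSpace ℝ (Fin n)) :
    ∃ u ∈ inputBox umin umax, flowMargin f g umin umax ν x = inner ℝ (ν x) (f x + g x u) ∧
      flowMargin f g umin umax ν x = inner ℝ (ν x) (f x) -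
        boxLPValue umin umax (-ContinuousLinearMap.adjoint (g x) (ν x)) := by
  obtain ⟨w, hw, heq, hle⟩ :=
    exists_boxLPValue_eq hu (-ContinuousLinearMap.adjoint (g x) (ν x))
  have hval : ∀ u, inner ℝ (ν x) (f x + g x u) = (inner ℝ (ν x) (f x) : ℝ) -
      inner ℝ (-ContinuousLinearMap.adjoint (g x) (ν x)) u := by
    intro u
    rw [inner_neg_left, ContinuousLinearMap.adjoint_inner_left, inner_add_right]
    ring
  have hmax : flowMargin f g umin umax ν x = inner ℝ (ν x) (f x + g x w) := by
    refine IsGreatest.csSup_eq ⟨⟨w, hw, rfl⟩, ?_⟩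
    rintro _ ⟨u, hu, rfl⟩
    have := hle u hu
    simp only [hval]
    linarith
  exact ⟨w, hw, hmax, by rw [hmax, hval, heq]⟩

/-- The flow margin is Lipschitz on the boundary, with the constant obtained from those of the
data and of the linear program. -/
lemma flowMargin_sub_le (hu : ∀ j, umin j ≤ umax j) {S : Set (EuclideanSpace ℝ (Fin n))}
    {Lnf Lng : ℝ≥0}
    (hLnf : LipschitzOnWith Lnf (fun x => inner ℝ (ν x) (f x)) S)
    (hLng : LipschitzOnWith Lng (fun x => ContinuousLinearMap.adjoint (g x) (ν x)) S)
    {x y : EuclideanSpace ℝ (Fin n)} (hx : x ∈ S) (hy : y ∈ S) :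
    flowMargin f g umin umax ν y - flowMargin f g umin umax ν x ≤
      (Lnf + boxLPLipschitz umin umax * Lng) * dist y x := by
  obtain ⟨-, -, -, hx'⟩ := flowMargin_eq f g ν hu x
  obtain ⟨-, -, -, hy'⟩ := flowMargin_eq f g ν hu y
  rw [hx', hy']
  have h1 := hLnf.dist_le_mul y hy x hx
  have h2 := hLng.dist_le_mul y hy x hx
  have h3 := abs_boxLPValue_sub_le hu (-ContinuousLinearMap.adjoint (g x) (ν x))
    (-ContinuousLinearMap.adjoint (g y) (ν y))
  rw [neg_sub_neg, ← dist_eq_norm] at h3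
  have h4 := mul_le_mul_of_nonneg_left h2 (boxLPLipschitz_nonneg (umin := umin) (umax := umax))
  rw [Real.dist_eq] at h1
  have h5 := le_abs_self (inner ℝ (ν y) (f y) - inner ℝ (ν x) (f x) : ℝ)
  have h6 := le_abs_self (boxLPValue umin umax (-ContinuousLinearMap.adjoint (g x) (ν x)) -
    boxLPValue umin umax (-ContinuousLinearMap.adjoint (g y) (ν y)))
  linarith

end LinearProgram

/-! ### Viability: Euler schemes and their limit. -/

section Viability

variable {E F : Type*} [NormedAddCommGroup E] [NormedSpace ℝ E] [NormedAddCommGroup F]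
  [NormedSpace ℝ F]

/-- From every point of `Ω`, arbitrarily short steps along admissible velocities stay in `Ω` up to
an error that is small compared to their length. -/
def HasViableSteps (f : E → E) (g : E → F →L[ℝ] E) (U : Set F) (Ω : Set E) : Prop :=
  ∀ y ∈ Ω, ∀ ε > 0, ∃ h, 0 < h ∧ h ≤ ε ∧ ∃ u ∈ U, ∃ z ∈ Ω, ‖z - y - h • (f y + g y u)‖ ≤ ε * h

variable {f : E → E} {g : E → F →L[ℝ] E} {U : Set F} {Ω : Set E} {ε M : ℝ}

/-- A step chosen at `y` with error `ε / 2` still works, with the same length, input and target, for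
all nearby points of `Ω` with error `ε`. Finitely many such neighbourhoods cover `Ω`. -/
lemma HasViableSteps.exists_uniform (hv : HasViableSteps f g U Ω) (hΩ : IsCompact Ω)
    (hf : ContinuousOn f Ω) (hg : ContinuousOn g Ω) (hε : 0 < ε) :
    ∃ h₀ > 0, ∀ x ∈ Ω, ∃ h, h₀ ≤ h ∧ h ≤ ε ∧ ∃ u ∈ U, ∃ z ∈ Ω,
      ‖z - x - h • (f x + g x u)‖ ≤ ε * h := by
  suffices ∃ h₀ > 0, ∀ x ∈ Ω, x ∈ Ω → ∃ h, h₀ ≤ h ∧ h ≤ ε ∧ ∃ u ∈ U, ∃ z ∈ Ω,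
      ‖z - x - h • (f x + g x u)‖ ≤ ε * h by
    obtain ⟨h₀, h, hh⟩ := this
    exact ⟨h₀, h, fun x hx => hh x hx hx⟩
  refine hΩ.induction_on (p := fun s => ∃ h₀ > 0, ∀ x ∈ s, x ∈ Ω → ∃ h, h₀ ≤ h ∧ h ≤ ε ∧
    ∃ u ∈ U, ∃ z ∈ Ω, ‖z - x - h • (f x + g x u)‖ ≤ ε * h) ⟨1, one_pos, by simp⟩ ?_ ?_ ?_
  · rintro s t hst ⟨h₀, hpos, h⟩
    exact ⟨h₀, hpos, fun x hx => h x (hst hx)⟩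
  · rintro s t ⟨h₁, hpos₁, H₁⟩ ⟨h₂, hpos₂, H₂⟩
    refine ⟨min h₁ h₂, lt_min hpos₁ hpos₂, ?_⟩
    rintro x (hx | hx) hxΩ
    · obtain ⟨h, hle, H⟩ := H₁ x hx hxΩ
      exact ⟨h, (min_le_left _ _).trans hle, H⟩
    · obtain ⟨h, hle, H⟩ := H₂ x hx hxΩ
      exact ⟨h, (min_le_right _ _).trans hle, H⟩
  · intro y hy
    obtain ⟨h, hpos, hle, u, hu, z, hz, hzy⟩ := hv y hy (ε / 2) (by positivity)
    have hlt : ‖z - y - h • (f y + g y u)‖ < ε * h := by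
      have : 0 < ε * h := by positivity
      linarith
    have hcont : ContinuousWithinAt (fun x => ‖z - x - h • (f x + g x u)‖) Ω y := by
      have h1 := hf y hy
      have h2 : ContinuousWithinAt (fun x => g x u) Ω y := (hg y hy).clm_apply
        continuousWithinAt_const
      exact ((continuousWithinAt_const.sub continuousWithinAt_id).sub
        ((h1.add h2).const_smul h)).norm
    refine ⟨{x | ‖z - x - h • (f x + g x u)‖ < ε * h}, hcont.eventually_lt_const hlt, h, hpos, ?_⟩
    intro x hx _
    exact ⟨h, le_rfl, by linarith, u, hu, z, hz, le_of_lt hx⟩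

/-- An approximate solution with time error `ε`: the state `X`, the accumulated input `V` and the
clock `T` are step functions whose increments obey the dynamics up to `ε`. -/
structure IsApproxSolution (f : E → E) (g : E → F →L[ℝ] E) (U : Set F) (Ω : Set E) (M : ℝ)
    (x₀ : E) (ε : ℝ) (X : ℝ → E) (V : ℝ → F) (T : ℝ → ℝ) : Prop where
  state_zero : X 0 = x₀
  input_zero : V 0 = 0
  clock_zero : T 0 = 0
  mem : ∀ t, X t ∈ Ω
  clock_le : ∀ t, 0 ≤ t → T t ≤ t
  lt_clock_add : ∀ t, 0 ≤ t → t ≤ T t + ε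
  exists_input : ∀ a b, 0 ≤ a → a ≤ b → ∃ v ∈ U, V b - V a = (T b - T a) • v
  norm_state_sub_le : ∀ a b, 0 ≤ a → a ≤ b → ‖X b - X a‖ ≤ (M + ε) * (T b - T a)
  -- `A` and `B` are free so that they can later be frozen at the limit state, which does not depend
  -- on the approximation.
  norm_error_le : ∀ a b, 0 ≤ a → a ≤ b → ∀ (A : E) (B : F →L[ℝ] E) (η : ℝ),
    (∀ y ∈ Ω, ‖y - X a‖ ≤ (M + ε) * (T b - T a) → ∀ u ∈ U,
      ‖(f y + g y u) - (A + B u)‖ ≤ η) →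
    ‖X b - X a - ((T b - T a) • A + B (V b - V a))‖ ≤ (η + ε) * (T b - T a)

/-- One-step errors telescope, and `B` being linear sees the inputs only through their weighted sum
`S`. -/
lemma norm_euler_error_le {x : ℕ → E} {u S : ℕ → F} {h t : ℕ → ℝ} (hh : ∀ k, 0 ≤ h k)
    (ht : ∀ k, t (k + 1) = t k + h k) (hS : ∀ k, S (k + 1) = S k + h k • u k)
    (hx : ∀ k, ‖x (k + 1) - x k - h k • (f (x k) + g (x k) (u k))‖ ≤ ε * h k)
    (A : E) (B : F →L[ℝ] E) (η : ℝ) {i j : ℕ} (hij : i ≤ j)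
    (hη : ∀ k, i ≤ k → k < j → ‖(f (x k) + g (x k) (u k)) - (A + B (u k))‖ ≤ η) :
    ‖x j - x i - ((t j - t i) • A + B (S j - S i))‖ ≤ (η + ε) * (t j - t i) := by
  induction j, hij using Nat.le_induction with
  | base => simp
  | succ j hij ih =>
    have ih' := ih fun k hk hkj => hη k hk (by omega)
    have h1 := hx j
    have h2 : ‖h j • ((f (x j) + g (x j) (u j)) - (A + B (u j)))‖ ≤ h j * η := by
      rw [norm_smul, Real.norm_of_nonneg (hh j)]
      exact mul_le_mul_of_nonneg_left (hη j hij (by omega)) (hh j)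
    have heq : x (j + 1) - x i - ((t (j + 1) - t i) • A + B (S (j + 1) - S i)) =
        (x j - x i - ((t j - t i) • A + B (S j - S i))) +
        (x (j + 1) - x j - h j • (f (x j) + g (x j) (u j))) +
        h j • ((f (x j) + g (x j) (u j)) - (A + B (u j))) := by
      rw [ht, hS]
      simp only [map_sub, map_add, map_smul]
      module
    rw [heq]
    refine (norm_add₃_le).trans ?_
    rw [ht]
    linarith

/-- The average of the inputs, weighted by step lengths, stays in the convex set `U`. -/
lemma exists_input_of_euler (hU : Convex ℝ U) (hne : U.Nonempty) {u S : ℕ → F} {h t : ℕ → ℝ}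
    (hh : ∀ k, 0 ≤ h k) (hu : ∀ k, u k ∈ U)
    (ht : ∀ k, t (k + 1) = t k + h k) (hS : ∀ k, S (k + 1) = S k + h k • u k)
    {i j : ℕ} (hij : i ≤ j) : ∃ v ∈ U, S j - S i = (t j - t i) • v := by
  have hmono : Monotone t := monotone_nat_of_le_succ fun k => by rw [ht]; linarith [hh k]
  induction j, hij using Nat.le_induction with
  | base => exact ⟨_, hne.some_mem, by simp⟩
  | succ j hij ih =>
    obtain ⟨v, hv, hvS⟩ := ih
    obtain ⟨w, hw, heq⟩ := hU.exists_mem_add_smul_eq hv (hu j) (sub_nonneg.2 (hmono hij)) (hh j)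
    refine ⟨w, hw, ?_⟩
    rw [ht, hS, add_sub_right_comm, add_sub_right_comm, hvS, ← heq]

lemma exists_isApproxSolution (hv : HasViableSteps f g U Ω) (hΩ : IsCompact Ω)
    (hf : ContinuousOn f Ω) (hg : ContinuousOn g Ω) (hU : Convex ℝ U) (hne : U.Nonempty)
    (hM : ∀ y ∈ Ω, ∀ u ∈ U, ‖f y + g y u‖ ≤ M) {x₀ : E} (hx₀ : x₀ ∈ Ω) (hε : 0 < ε) :
    ∃ X V T, IsApproxSolution f g U Ω M x₀ ε X V T := by
  obtain ⟨h₀, hh₀, hstep⟩ := hv.exists_uniform hΩ hf hg hε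
  choose! h hlow hupp u hu z hz hzx using hstep
  set x : ℕ → E := fun k => z^[k] x₀ with hxdef
  have hxs : ∀ k, x (k + 1) = z (x k) := fun k => Function.iterate_succ_apply' z k x₀
  have hxΩ : ∀ k, x k ∈ Ω := by
    intro k
    induction k with
    | zero => exact hx₀
    | succ k ih => rw [hxs]; exact hz _ ih
  set t : ℕ → ℝ := fun k => ∑ j ∈ Finset.range k, h (x j) with htdef
  set S : ℕ → F := fun k => ∑ j ∈ Finset.range k, h (x j) • u (x j) with hSdef
  have ht : ∀ k, t (k + 1) = t k + h (x k) := fun k => Finset.sum_range_succ _ _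
  have hS : ∀ k, S (k + 1) = S k + h (x k) • u (x k) := fun k => Finset.sum_range_succ _ _
  have ht0 : t 0 = 0 := Finset.sum_range_zero _
  have hS0 : S 0 = 0 := Finset.sum_range_zero _
  have hpos : ∀ k, 0 < h (x k) := fun k => hh₀.trans_le (hlow _ (hxΩ k))
  have hmono : StrictMono t := strictMono_nat_of_lt_succ fun k => by rw [ht]; linarith [hpos k]
  have hgrow : ∀ k : ℕ, k * h₀ ≤ t k := by
    intro k
    induction k with
    | zero => simp [ht0]
    | succ k ih => rw [ht]; push_cast; linarith [hlow _ (hxΩ k)]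
  -- The step containing time `s`; it exists because the lower bound `h₀` makes the grid times
  -- unbounded.
  have hidx : ∀ s : ℝ, ∃ i, 0 ≤ s → t i ≤ s ∧ s < t (i + 1) := by
    intro s
    by_cases hs : 0 ≤ s
    · have hex : ∃ i, s < t (i + 1) := by
        obtain ⟨i, hi⟩ := exists_nat_gt (s / h₀)
        refine ⟨i, ?_⟩
        rw [div_lt_iff₀ hh₀] at hi
        exact hi.trans_le ((hgrow i).trans (hmono.monotone i.le_succ))
      classical
      refine ⟨Nat.find hex, fun _ => ⟨?_, Nat.find_spec hex⟩⟩
      rcases hcase : Nat.find hex with _ | k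
      · rwa [ht0]
      · exact not_lt.1 (Nat.find_min hex (m := k) (by omega))
    · exact ⟨0, fun h => absurd h hs⟩
  choose idx hidx using hidx
  have hidx_mono : ∀ a b, 0 ≤ a → a ≤ b → idx a ≤ idx b := by
    intro a b ha hab
    have h1 := (hidx a ha).1
    have h2 := (hidx b (ha.trans hab)).2
    exact Nat.lt_succ_iff.1 (hmono.lt_iff_lt.1 (h1.trans_lt (hab.trans_lt h2)))
  have hidx0 : idx 0 = 0 := by
    have := (hidx 0 le_rfl).1
    rw [← ht0] at this
    exact Nat.le_zero.1 (hmono.le_iff_le.1 this)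
  have herr := fun A B η i j => norm_euler_error_le (i := i) (j := j) (f := f) (g := g)
    (x := x) (u := fun k => u (x k)) (h := fun k => h (x k)) (fun k => (hpos k).le) ht hS
    (fun k => by rw [hxs]; exact hzx _ (hxΩ k)) A B η
  have hlip : ∀ i j, i ≤ j → ‖x j - x i‖ ≤ (M + ε) * (t j - t i) := by
    intro i j hij
    -- With `A = 0` and `B = 0` the error estimate becomes a Lipschitz bound.
    simpa using herr 0 0 M i j hij fun k _ _ => by simpa using hM _ (hxΩ k) _ (hu _ (hxΩ k))
  have hM0 : 0 ≤ M := (norm_nonneg _).trans (hM x₀ hx₀ _ hne.some_mem)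
  refine ⟨fun s => x (idx s), fun s => S (idx s), fun s => t (idx s), ?_⟩
  refine ⟨by simp [hidx0, hxdef], by simp only [hidx0, hS0], by simp only [hidx0, ht0],
    fun s => hxΩ _, fun s hs => (hidx s hs).1, ?_, ?_, ?_, ?_⟩
  · intro s hs
    have h1 := (hidx s hs).2
    rw [ht] at h1
    linarith [hupp _ (hxΩ (idx s))]
  · intro a b ha hab
    exact exists_input_of_euler hU hne (fun k => (hpos k).le) (fun k => hu _ (hxΩ k)) ht hS
      (hidx_mono a b ha hab)
  · intro a b ha hab
    exact hlip _ _ (hidx_mono a b ha hab)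
  · intro a b ha hab A B η hη
    refine herr A B η _ _ (hidx_mono a b ha hab) fun k hk hkb => ?_
    refine hη _ (hxΩ k) ((hlip _ _ hk).trans ?_) _ (hu _ (hxΩ k))
    have := hmono.monotone hkb.le
    gcongr

lemma exists_tendsto_ultrafilter {ι G : Type*} [TopologicalSpace G] {K : Set G} (hK : IsCompact K)
    (𝓤 : Ultrafilter ι) {y : ι → G} (hy : ∀ k, y k ∈ K) :
    ∃ q ∈ K, Filter.Tendsto y 𝓤 (𝓝 q) :=
  hK.ultrafilter_le_nhds (𝓤.map y) (by
    rw [Filter.le_principal_iff]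
    exact Filter.mem_map.2 (Filter.Eventually.of_forall hy))

/-- A limit of approximate solutions: state and accumulated input are Lipschitz on `[0, ∞)` and
satisfy the dynamics in the sense of right difference quotients. -/
lemma exists_viable_pair (hv : HasViableSteps f g U Ω) (hΩ : IsCompact Ω)
    (hf : ContinuousOn f Ω) (hg : ContinuousOn g Ω) (hU : Convex ℝ U) (hUc : IsCompact U)
    (hne : U.Nonempty)
    (hM : ∀ y ∈ Ω, ∀ u ∈ U, ‖f y + g y u‖ ≤ M) {x₀ : E} (hx₀ : x₀ ∈ Ω) :
    ∃ (x : ℝ → E) (W : ℝ → F), x 0 = x₀ ∧ (∀ t, 0 ≤ t → x t ∈ Ω) ∧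
      (∀ a b, 0 ≤ a → a ≤ b → ‖x b - x a‖ ≤ M * (b - a)) ∧
      (∀ a b, 0 ≤ a → a ≤ b → ∃ v ∈ U, W b - W a = (b - a) • v) ∧
      ∀ a, 0 ≤ a → ∀ η > 0, ∃ ρ > 0, ∀ b, a ≤ b → b < a + ρ →
        ‖x b - x a - ((b - a) • f (x a) + g (x a) (W b - W a))‖ ≤ η * (b - a) := by
  set e : ℕ → ℝ := fun k => 1 / ((k : ℝ) + 1) with he
  have hepos : ∀ k, 0 < e k := fun k => by positivity
  choose X V T hA using fun k => exists_isApproxSolution (M := M) hv hΩ hf hg hU hne hM hx₀ (hepos k)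
  -- Along one ultrafilter the states and accumulated inputs converge at every nonnegative time at
  -- once, with no subsequence extraction.
  set 𝓤 : Ultrafilter ℕ := Filter.hyperfilter ℕ with h𝓤
  have hle : (𝓤 : Filter ℕ) ≤ Filter.atTop := Nat.hyperfilter_le_atTop
  have helim : Filter.Tendsto e 𝓤 (𝓝 0) := tendsto_one_div_add_atTop_nhds_zero_nat.mono_left hle
  have hTlim : ∀ t, 0 ≤ t → Filter.Tendsto (fun k => T k t) 𝓤 (𝓝 t) := by
    intro t ht
    have h1 : Filter.Tendsto (fun k => t - e k) 𝓤 (𝓝 t) := by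
      simpa using tendsto_const_nhds.sub helim
    exact tendsto_of_tendsto_of_tendsto_of_le_of_le h1 tendsto_const_nhds
      (fun k => by have := (hA k).lt_clock_add t ht; simp only; linarith)
      (fun k => (hA k).clock_le t ht)
  have hXlim : ∀ t, ∃ q ∈ Ω, Filter.Tendsto (fun k => X k t) 𝓤 (𝓝 q) := fun t =>
    exists_tendsto_ultrafilter hΩ 𝓤 fun k => (hA k).mem t
  have hdV : ∀ a b, 0 ≤ a → a ≤ b →
      ∃ v ∈ U, Filter.Tendsto (fun k => V k b - V k a) 𝓤 (𝓝 ((b - a) • v)) := by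
    intro a b ha hab
    choose v hvU hvV using fun k => (hA k).exists_input a b ha hab
    obtain ⟨q, hq, hvq⟩ := exists_tendsto_ultrafilter hUc 𝓤 hvU
    refine ⟨q, hq, ?_⟩
    simp only [hvV]
    exact ((hTlim b (ha.trans hab)).sub (hTlim a ha)).smul hvq
  have hVlim : ∀ t, ∃ w, 0 ≤ t → Filter.Tendsto (fun k => V k t) 𝓤 (𝓝 w) := by
    intro t
    by_cases ht : 0 ≤ t
    · obtain ⟨v, -, hv⟩ := hdV 0 t le_rfl ht
      simp only [(hA _).input_zero, sub_zero] at hv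
      exact ⟨_, fun _ => hv⟩
    · exact ⟨0, fun h => absurd h ht⟩
  choose x hxΩ hx using hXlim
  choose W hW using hVlim
  have hdT : ∀ a b, 0 ≤ a → a ≤ b →
      Filter.Tendsto (fun k => T k b - T k a) 𝓤 (𝓝 (b - a)) := fun a b ha hab =>
    (hTlim b (ha.trans hab)).sub (hTlim a ha)
  have hrad : ∀ c a b, 0 ≤ a → a ≤ b →
      Filter.Tendsto (fun k => (c + e k) * (T k b - T k a)) 𝓤 (𝓝 (c * (b - a))) := by
    intro c a b ha hab
    simpa using (helim.const_add c).mul (hdT a b ha hab)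
  refine ⟨x, W, ?_, fun t _ => hxΩ t, ?_, ?_, ?_⟩
  · refine tendsto_nhds_unique (hx 0) ?_
    simp only [(hA _).state_zero]
    exact tendsto_const_nhds
  · intro a b ha hab
    exact le_of_tendsto_of_tendsto ((hx b).sub (hx a)).norm (hrad M a b ha hab)
      (Filter.Eventually.of_forall fun k => (hA k).norm_state_sub_le a b ha hab)
  · intro a b ha hab
    obtain ⟨v, hv, hlimv⟩ := hdV a b ha hab
    exact ⟨v, hv, tendsto_nhds_unique ((hW b (ha.trans hab)).sub (hW a ha)) hlimv⟩
  · intro a ha η hη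
    obtain ⟨R, hR0, hR⟩ := hUc.isBounded.exists_pos_norm_le
    have hM0 : 0 ≤ M := (norm_nonneg _).trans (hM x₀ hx₀ _ hne.some_mem)
    have hcf := Metric.continuousWithinAt_iff.1 (hf _ (hxΩ a)) (η / 2) (by positivity)
    have hcg := Metric.continuousWithinAt_iff.1 (hg _ (hxΩ a)) (η / (2 * R)) (by positivity)
    obtain ⟨δ₁, hδ₁, hcf⟩ := hcf
    obtain ⟨δ₂, hδ₂, hcg⟩ := hcg
    set δ := min δ₁ δ₂ with hδ
    have hδ0 : 0 < δ := lt_min hδ₁ hδ₂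
    have hnear : ∀ y ∈ Ω, ‖y - x a‖ < δ → ∀ u ∈ U,
        ‖(f y + g y u) - (f (x a) + g (x a) u)‖ ≤ η := by
      intro y hy hya u hu
      rw [← dist_eq_norm] at hya
      have h1 := hcf hy (hya.trans_le (min_le_left _ _))
      have h2 := hcg hy (hya.trans_le (min_le_right _ _))
      rw [dist_eq_norm] at h1 h2
      have h3 : ‖(g y - g (x a)) u‖ ≤ η / (2 * R) * R :=
        ((g y - g (x a)).le_opNorm u).trans (by gcongr; exact hR u hu)
      have h4 : η / (2 * R) * R = η / 2 := by field_simp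
      have h5 : (f y + g y u) - (f (x a) + g (x a) u) =
          (f y - f (x a)) + (g y - g (x a)) u := by
        simp only [sub_apply]
        abel
      rw [h5]
      refine (norm_add_le _ _).trans ?_
      linarith
    -- Speed about `M` over this time costs less than `δ / 2`; the other `δ / 2` covers the distance
    -- from `X k a` to `x a`.
    refine ⟨δ / (2 * (M + 1)), by positivity, fun b hab hb => ?_⟩
    have hrδ : M * (b - a) < δ / 2 := by
      have h1 : b - a < δ / (2 * (M + 1)) := by linarith
      rw [lt_div_iff₀ (by positivity)] at h1
      nlinarith
    have hev1 := (hrad M a b ha hab).eventually_lt_const hrδ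
    have hev2 : ∀ᶠ k in (𝓤 : Filter ℕ), dist (X k a) (x a) < δ / 2 :=
      Metric.tendsto_nhds.1 (hx a) _ (by positivity)
    have hgW : Filter.Tendsto (fun k => g (x a) (V k b - V k a)) 𝓤
        (𝓝 (g (x a) (W b - W a))) :=
      ((g (x a)).continuous.tendsto _).comp ((hW b (ha.trans hab)).sub (hW a ha))
    refine le_of_tendsto_of_tendsto (((hx b).sub (hx a)).sub
      (((hdT a b ha hab).smul_const (f (x a))).add hgW)).norm
      (hrad η a b ha hab) ?_
    filter_upwards [hev1, hev2] with k hk1 hk2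
    refine (hA k).norm_error_le a b ha hab _ _ η fun y hy hyX => hnear y hy ?_
    rw [dist_eq_norm] at hk2
    calc ‖y - x a‖ = ‖(y - X k a) + (X k a - x a)‖ := by rw [sub_add_sub_cancel]
      _ ≤ ‖y - X k a‖ + ‖X k a - x a‖ := norm_add_le _ _
      _ < δ := by linarith

end Viability

/-- The fundamental theorem of calculus for Lipschitz curves in a finite-dimensional space. -/
lemma intervalIntegrable_deriv_and_integral_eq_of_lipschitzWith {E : Type*} [NormedAddCommGroup E]
    [NormedSpace ℝ E] [FiniteDimensional ℝ E] {C : ℝ≥0} {x : ℝ → E} (hx : LipschitzWith C x)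
    (a b : ℝ) :
    IntervalIntegrable (deriv x) MeasureTheory.volume a b ∧ ∫ s in a..b, deriv x s = x b - x a := by
  have hbound : ∀ s, ‖deriv x s‖ ≤ C := fun s => norm_deriv_le_of_lipschitz hx
  have hint : ∀ c d, IntervalIntegrable (deriv x) MeasureTheory.volume c d := fun c d =>
    (intervalIntegrable_const (c := (C : ℝ))).mono_fun'
      (stronglyMeasurable_deriv x).aestronglyMeasurable (Filter.Eventually.of_forall hbound)
  refine ⟨hint a b, ?_⟩
  -- `G` is Lipschitz with derivative zero almost everywhere, hence constant on the interval.
  set G : ℝ → E := fun t => x t - ∫ s in a..t, deriv x s with hG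
  have hprim : LipschitzWith C fun t => ∫ s in a..t, deriv x s := by
    refine LipschitzWith.of_dist_le_mul fun s t => ?_
    rw [dist_eq_norm, intervalIntegral.integral_interval_sub_left (hint _ _) (hint _ _),
      Real.dist_eq]
    exact intervalIntegral.norm_integral_le_of_norm_le_const fun r _ => hbound r
  have hGlip : LipschitzWith (C + C) G := hx.sub hprim
  have hGder : ∀ᵐ t, t ∈ Set.uIcc a b → HasDerivAt G 0 t := by
    filter_upwards [hx.ae_differentiableAt_real, (hint a b).ae_hasDerivAt_integral] with t h1 h2 ht
    have h3 := h1.hasDerivAt.sub (h2 ht a Set.left_mem_uIcc)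
    rw [sub_self] at h3
    exact h3
  have hGac : AbsolutelyContinuousOnInterval G a b :=
    (hGlip.lipschitzOnWith (s := Set.uIcc a b)).absolutelyContinuousOnInterval
  obtain ⟨c, hc⟩ := hGac.const_of_ae_hasDerivAt_zero hGder
  have h1 := hc a Set.left_mem_uIcc
  have h2 := hc b Set.right_mem_uIcc
  simp only [hG, intervalIntegral.integral_same, sub_zero] at h1 h2
  rw [h1, ← h2]
  abel

/-! ### From the limit pair to a measurable control and a solution. -/

section Viability

variable {E F : Type*} [NormedAddCommGroup E] [NormedSpace ℝ E] [NormedAddCommGroup F]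
  [NormedSpace ℝ F] {f : E → E} {g : E → F →L[ℝ] E} {U : Set F} {Ω : Set E}

/-- Freezing the curve before `t₀` yields a globally Lipschitz function, to which almost everywhere
differentiability applies. -/
lemma lipschitzWith_comp_max_sub {G : Type*} [NormedAddCommGroup G] {C : ℝ≥0} {y : ℝ → G}
    (hy : ∀ a b, 0 ≤ a → a ≤ b → ‖y b - y a‖ ≤ C * (b - a)) (t₀ : ℝ) :
    LipschitzWith C fun t => y (max (t - t₀) 0) := by
  have hmono : ∀ s t : ℝ, s ≤ t →
      dist (y (max (t - t₀) 0)) (y (max (s - t₀) 0)) ≤ C * dist t s := by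
    intro s t hst
    have h1 : max (s - t₀) 0 ≤ max (t - t₀) 0 := max_le_max (by linarith) le_rfl
    have h2 : max (t - t₀) 0 - max (s - t₀) 0 ≤ t - s := by
      have := abs_max_sub_max_le_abs (t - t₀) (s - t₀) 0
      rw [sub_sub_sub_cancel_right, abs_of_nonneg (sub_nonneg.2 hst)] at this
      exact (le_abs_self _).trans this
    rw [dist_eq_norm, Real.dist_eq, abs_of_nonneg (sub_nonneg.2 hst)]
    refine (hy _ _ (le_max_right _ _) h1).trans ?_
    gcongr
  refine LipschitzWith.of_dist_le_mul fun s t => ?_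
  rcases le_total s t with h | h
  · rw [dist_comm, dist_comm s]
    exact hmono s t h
  · exact hmono t s h

/-- A viability theorem: if short steps along admissible velocities are possible from every point
of the compact set `Ω`, then every point of `Ω` is the start of a solution that stays in `Ω`. -/
theorem HasViableSteps.exists_solution [FiniteDimensional ℝ E] [FiniteDimensional ℝ F]
    [MeasurableSpace F] [BorelSpace F]
    (hv : HasViableSteps f g U Ω) (hΩ : IsCompact Ω)
    (hf : ContinuousOn f Ω) (hg : ContinuousOn g Ω) (hU : Convex ℝ U) (hUc : IsCompact U)
    {u₀ : F} (hu₀ : u₀ ∈ U) {x₀ : E} (hx₀ : x₀ ∈ Ω) (t₀ : ℝ) :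
    ∃ (u : ℝ → F) (x : ℝ → E) (C : ℝ≥0), Measurable u ∧ (∀ t, u t ∈ U) ∧ LipschitzWith C x ∧
      x t₀ = x₀ ∧ (∀ t, x t ∈ Ω) ∧
      ∀ᵐ t, t₀ < t → deriv x t = f (x t) + g (x t) (u t) := by
  obtain ⟨Rf, hRf⟩ := (hΩ.image_of_continuousOn hf).isBounded.exists_norm_le
  obtain ⟨Rg, hRg⟩ := (hΩ.image_of_continuousOn hg).isBounded.exists_norm_le
  obtain ⟨R, hR⟩ := hUc.isBounded.exists_norm_le
  have hR0 : 0 ≤ R := (norm_nonneg _).trans (hR u₀ hu₀)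
  have hRg0 : 0 ≤ Rg := (norm_nonneg _).trans (hRg _ ⟨x₀, hx₀, rfl⟩)
  have hRf0 : 0 ≤ Rf := (norm_nonneg _).trans (hRf _ ⟨x₀, hx₀, rfl⟩)
  have hM : ∀ y ∈ Ω, ∀ u ∈ U, ‖f y + g y u‖ ≤ Rf + Rg * R := by
    intro y hy u hu
    refine (norm_add_le _ _).trans (add_le_add (hRf _ ⟨y, hy, rfl⟩) ?_)
    refine ((g y).le_opNorm u).trans ?_
    gcongr
    exacts [hRg _ ⟨y, hy, rfl⟩, hR u hu]
  obtain ⟨x, W, hx0, hxΩ, hxlip, hWinc, hdyn⟩ :=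
    exists_viable_pair hv hΩ hf hg hU hUc ⟨u₀, hu₀⟩ hM hx₀
  set y : ℝ → E := fun t => x (max (t - t₀) 0) with hy
  set Z : ℝ → F := fun t => W (max (t - t₀) 0) with hZ
  have hylip : LipschitzWith ⟨Rf + Rg * R, by positivity⟩ y := lipschitzWith_comp_max_sub hxlip t₀
  have hZlip : LipschitzWith ⟨R, hR0⟩ Z := by
    refine lipschitzWith_comp_max_sub (fun a b ha hab => ?_) t₀
    obtain ⟨v, hv, hvW⟩ := hWinc a b ha hab
    rw [hvW, norm_smul, Real.norm_of_nonneg (sub_nonneg.2 hab), mul_comm]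
    exact mul_le_mul_of_nonneg_right (hR v hv) (sub_nonneg.2 hab)
  classical
  -- The control is the derivative of the accumulated input, so no measurable selection is needed;
  -- `u₀` only fills in where that derivative is not in `U`, which after `t₀` is a null set.
  refine ⟨fun t => if deriv Z t ∈ U then deriv Z t else u₀, y, _, ?_, ?_, hylip, ?_,
    fun t => hxΩ _ (le_max_right _ _), ?_⟩
  · exact Measurable.ite (measurable_deriv Z hUc.isClosed.measurableSet) (measurable_deriv Z)
      measurable_const
  · intro t
    dsimp only
    split_ifs with h
    exacts [h, hu₀]
  · simp [hy, hx0]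
  · filter_upwards [hylip.ae_differentiableAt_real, hZlip.ae_differentiableAt_real] with t h1 h2 ht
    have hyt : ∀ s, t ≤ s → y s = x (s - t₀) := fun s hs => by
      simp only [hy]; rw [max_eq_left (by linarith)]
    have hZt : ∀ s, t ≤ s → Z s = W (s - t₀) := fun s hs => by
      simp only [hZ]; rw [max_eq_left (by linarith)]
    have ht0 : 0 ≤ t - t₀ := by linarith
    have hmemU : deriv Z t ∈ U := by
      have hslope := (hasDerivAt_iff_tendsto_slope.1 h2.hasDerivAt).mono_left
        (nhdsWithin_mono t (show Set.Ioi t ⊆ {t}ᶜ from fun s hs => ne_of_gt hs))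
      refine hUc.isClosed.mem_of_tendsto hslope ?_
      filter_upwards [self_mem_nhdsWithin] with s (hs : t < s)
      obtain ⟨v, hvU, hvW⟩ := hWinc (t - t₀) (s - t₀) ht0 (by linarith)
      rw [slope_def_module, hZt s hs.le, hZt t le_rfl, hvW, sub_sub_sub_cancel_right, smul_smul,
        inv_mul_cancel₀ (by linarith), one_smul]
      exact hvU
    rw [if_pos hmemU]
    -- The one-sided estimate differentiates `y - g (y t) Z` with `g` frozen at time `t`; comparison
    -- with the two-sided derivative gives the equation.
    have hright : HasDerivWithinAt (fun s => y s - g (y t) (Z s)) (f (y t)) (Set.Ici t) t := by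
      rw [hasDerivWithinAt_iff_isLittleO, Asymptotics.isLittleO_iff]
      intro η hη
      obtain ⟨ρ, hρ, hest⟩ := hdyn (t - t₀) ht0 η hη
      filter_upwards [Ico_mem_nhdsGE (show t < t + ρ by linarith)] with s hs
      have h3 := hest (s - t₀) (by linarith [hs.1]) (by linarith [hs.2])
      rw [← hyt s hs.1, ← hyt t le_rfl, ← hZt s hs.1, ← hZt t le_rfl,
        sub_sub_sub_cancel_right] at h3
      rw [Real.norm_of_nonneg (sub_nonneg.2 hs.1)]
      convert h3 using 2
      rw [map_sub]
      abel
    have hboth : HasDerivAt (fun s => y s - g (y t) (Z s)) (deriv y t - g (y t) (deriv Z t)) t :=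
      h1.hasDerivAt.sub ((g (y t)).hasFDerivAt.comp_hasDerivAt t h2.hasDerivAt)
    have := (uniqueDiffOn_Ici t t Set.self_mem_Ici).eq_deriv _ hboth.hasDerivWithinAt hright
    rw [← this]
    abel

end Viability

end ControlInvariance

/-! ### From the sampled margin condition to control invariance. -/

theorem theorem1 {n m N : ℕ} (X Ω : Set (EuclideanSpace ℝ (Fin n)))
    (f : EuclideanSpace ℝ (Fin n) → EuclideanSpace ℝ (Fin n))
    (g : EuclideanSpace ℝ (Fin n) → EuclideanSpace ℝ (Fin m) →L[ℝ] EuclideanSpace ℝ (Fin n))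
    (hf : ContinuousOn f X) (hg : ContinuousOn g X)
    (umin umax : EuclideanSpace ℝ (Fin m)) (hu : ∀ j, umin j ≤ umax j)
    (hΩX : Ω ⊆ X) (hΩclosed : IsClosed Ω) (hΩbdd : Bornology.IsBounded Ω)
    (hmanifold : ControlInvariance.IsC1Hypersurface (frontier Ω))
    (ν : EuclideanSpace ℝ (Fin n) → EuclideanSpace ℝ (Fin n))
    (hν : ∀ x ∈ frontier Ω, ControlInvariance.IsInwardUnitNormal Ω x (ν x))
    (Lnf Lng : ℝ≥0)
    (hLnf : LipschitzOnWith Lnf (fun x => inner ℝ (ν x) (f x)) (frontier Ω))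
    (hLng : LipschitzOnWith Lng (fun x => ContinuousLinearMap.adjoint (g x) (ν x)) (frontier Ω))
    (Lb : ℝ) (hLb : Lb = Lnf + ControlInvariance.boxLPLipschitz umin umax * Lng)
    (xc : Fin N → EuclideanSpace ℝ (Fin n)) (r : Fin N → ℝ) (hr : ∀ i, 0 ≤ r i)
    (hxc : ∀ i, xc i ∈ frontier Ω)
    (hcover : frontier Ω ⊆ ⋃ i, Metric.closedBall (xc i) (r i))
    (hmargin : ∀ i, Lb * r i ≤ ControlInvariance.flowMargin f g umin umax ν (xc i) ∧
      0 ≤ Lb * r i) :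
    ControlInvariance.IsControlInvariant f g (ControlInvariance.inputBox umin umax) Ω := by
  have hmin : umin ∈ ControlInvariance.inputBox umin umax := fun j => ⟨le_rfl, hu j⟩
  have hLb0 : 0 ≤ Lb := by
    have := ControlInvariance.boxLPLipschitz_nonneg (umin := umin) (umax := umax)
    rw [hLb]
    positivity
  have hflow : ∀ y ∈ frontier Ω, ∃ u ∈ ControlInvariance.inputBox umin umax,
      0 ≤ (inner ℝ (ν y) (f y + g y u) : ℝ) := by
    intro y hy
    obtain ⟨u, hubox, hval, -⟩ := ControlInvariance.flowMargin_eq f g ν hu y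
    refine ⟨u, hubox, ?_⟩
    obtain ⟨i, hi⟩ := Set.mem_iUnion.1 (hcover hy)
    rw [Metric.mem_closedBall'] at hi
    -- Transport from the control point: `b*(y) ≥ b*(x_i) - Lb r_i ≥ 0`.
    have h1 := ControlInvariance.flowMargin_sub_le f g ν hu hLnf hLng hy (hxc i)
    rw [← hLb] at h1
    have h2 := mul_le_mul_of_nonneg_left hi hLb0
    rw [← hval]
    linarith [(hmargin i).1]
  have hsteps : ControlInvariance.HasViableSteps f g (ControlInvariance.inputBox umin umax) Ω := by
    intro y hy ε hε
    by_cases hfr : y ∈ frontier Ω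
    · obtain ⟨u, hubox, hpos⟩ := hflow y hfr
      have hnorm := (hν y hfr).norm_eq_one
      set v := f y + g y u with hv
      -- The tilt makes the normal component at least `ε`, so `p` lies in the cone of slope `ε /
      -- ‖p‖`, while the step `h • p` misses `h • v` by exactly `ε * h`.
      set p := v + ε • ν y with hp
      have hin : ε ≤ inner ℝ (ν y) p := by
        rw [hp, inner_add_right, inner_smul_right, real_inner_self_eq_norm_sq, hnorm]
        linarith
      have hp0 : p ≠ 0 := by
        intro h
        rw [h, inner_zero_right] at hin
        linarith
      have hpn : 0 < ‖p‖ := norm_pos_iff.2 hp0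
      obtain ⟨δ, hδ, hmem⟩ := (hν y hfr).eventually_mem hfr (ε := ε / ‖p‖) (by positivity)
      set h := min ε (δ / (2 * ‖p‖)) with hh
      have hh0 : 0 < h := by positivity
      refine ⟨h, hh0, min_le_left _ _, u, hubox, y + h • p, hmem _ ?_ ?_ ?_, ?_⟩
      · rw [norm_smul, Real.norm_of_nonneg hh0.le]
        have : h * ‖p‖ ≤ δ / (2 * ‖p‖) * ‖p‖ := by gcongr; exact min_le_right _ _
        have h2 : δ / (2 * ‖p‖) * ‖p‖ = δ / 2 := by field_simp
        linarith
      · exact smul_ne_zero hh0.ne' hp0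
      · rw [norm_smul, Real.norm_of_nonneg hh0.le, inner_smul_right]
        calc ε / ‖p‖ * (h * ‖p‖) = h * ε := by field_simp
          _ ≤ _ := by gcongr
      · have : y + h • p - y - h • v = (ε * h) • ν y := by rw [hp]; module
        rw [this, norm_smul, hnorm, mul_one, Real.norm_of_nonneg (by positivity)]
    -- In the interior any input serves, with no error, once the step is short enough.
    · have hint : y ∈ interior Ω := by
        by_contra hni
        exact hfr ⟨subset_closure hy, hni⟩
      obtain ⟨ρ, hρ, hsub⟩ := Metric.mem_nhds_iff.1 (mem_interior_iff_mem_nhds.1 hint)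
      set v := f y + g y umin with hv
      set h := min ε (ρ / (2 * (‖v‖ + 1))) with hh
      have hh0 : 0 < h := by positivity
      refine ⟨h, hh0, min_le_left _ _, umin, hmin, y + h • v, hsub ?_, ?_⟩
      · rw [mem_ball_iff_norm, add_sub_cancel_left, norm_smul, Real.norm_of_nonneg hh0.le]
        calc h * ‖v‖ ≤ ρ / (2 * (‖v‖ + 1)) * (‖v‖ + 1) := by
              gcongr
              exacts [min_le_right _ _, by linarith]
          _ = ρ / 2 := by field_simp
          _ < ρ := by linarith
      · rw [add_sub_cancel_left, sub_self, norm_zero]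
        positivity
  intro t₀ x₀ hx₀
  obtain ⟨u, x, C, hum, hubox, hxlip, hx0, hxΩ, hode⟩ :=
    hsteps.exists_solution (Metric.isCompact_of_isClosed_isBounded hΩclosed hΩbdd)
      (hf.mono hΩX) (hg.mono hΩX) ControlInvariance.convex_inputBox
      ControlInvariance.isCompact_inputBox hmin hx₀ t₀
  have hae : ∀ t, t₀ ≤ t → ∀ᵐ s, s ∈ Set.uIoc t₀ t → deriv x s = f (x s) + g (x s) (u s) := by
    intro t ht
    filter_upwards [hode] with s hs hst
    rw [Set.uIoc_of_le ht] at hst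
    exact hs hst.1
  refine ⟨u, x, hum, fun t _ => hubox t, ⟨hxlip.continuous.continuousOn, fun t ht => ?_,
    fun t ht => ?_⟩, hx0, fun t _ => hxΩ t⟩
  · refine (ControlInvariance.intervalIntegrable_deriv_and_integral_eq_of_lipschitzWith
      hxlip t₀ t).1.congr_ae ?_
    exact (MeasureTheory.ae_restrict_iff' measurableSet_uIoc).2 (hae t ht)
  · rw [← intervalIntegral.integral_congr_ae (hae t ht),
      (ControlInvariance.intervalIntegrable_deriv_and_integral_eq_of_lipschitzWith
        hxlip t₀ t).2]
    abel
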